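/- All graphs are finite and may have loops and parallel edges. The degree of a vertex is the number of edges incident with it, each loop being counted twice; the maximum degree of a graph is the maximum of the degrees of its vertices. For integers $k\ge 0$ and $N\ge 1$, a graph $G$ is *$k$-colorable with clustering $N$* if $V(G)$ can be partitioned into $k$ (possibly empty) sets such that each set induces a subgraph of $G$ all of whose components have at most $N$ vertices. A *tree-decomposition* of $G$ is a pair $(T,\mathcal X)$, where $T$ is a tree and $\mathcal X=(X_t : t\in V(T))$ is a collection of subsets of $V(G)$ (the *bags*) such that $\bigcup_{t\in V(T)}X_t=V(G)$; for every edge $e$ of $G$ some $X_t$ contains all ends of $e$; and for every $v\in V(G)$ the set $\{t\in V(T): v\in X_t\}$ induces a connected subgraph of $T$. Its *adhesion* is $\max_{tt'\in E(T)}|X_t\cap X_{t'}|$ (and $0$ if $T$ has no edge). The *torso* at $t$ is the graph obtained from $G[X_t]$ by adding, for each neighbor $t'$ of $t$ in $T$, edges such that $X_t\cap X_{t'}$ is a clique. **Corollary 1.4.** For any positive integers $\eta$, $d$ and $N$, there exists a positive integer $N^*$ such that the following holds. For every integer $k\ge 0$, every graph $G$ of maximum degree at most $d$ and every tree-decomposition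 $(T,\mathcal X)$ of $G$ of adhesion at most $\eta$: 1. if $k\ge 2$ and for every $t\in V(T)$ the torso at $t$ in $(T,\mathcal X)$ is $k$-colorable with clustering $N$, then $G$ is $k$-colorable with clustering $N^*$; and 2. if for every $t\in V(T)$ the induced subgraph $G[X_t]$ is $k$-colorable with clustering $N$, then $G$ is $(k+1)$-colorable with clustering $N^*$. -/

import Mathlib

/-!
Graphs are Mathlib's `Graph α β`: multigraphs with vertex set `V(G) : Set α` and edge set
`E(G) : Set β`, where loops and parallel edges are allowed.
-/

universe u v w

namespace Graph

/-- The degree of `x`: the number of edges incident with `x`, each loop being counted twice. -/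
noncomputable def degreeENat {α : Type u} {β : Type v} (G : Graph α β) (x : α) : ℕ∞ :=
  (G.incidenceSet x).encard + (G.loopSet x).encard

/-- The maximum degree of `G` (it is `0` if `G` has no vertex). -/
noncomputable def maxDegreeENat {α : Type u} {β : Type v} (G : Graph α β) : ℕ∞ :=
  ⨆ x ∈ G.vertexSet, G.degreeENat x

/-- The vertex set of the component of `G` that contains the vertex `x`: all vertices that can be
reached from `x` by successively moving along edges of `G`. -/
def componentAt {α : Type u} {β : Type v} (G : Graph α β) (x : α) : Set α :=
  {y | Relation.ReflTransGen G.Adj x y}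

/-- `G` is `k`-colorable with clustering `N`: there is a function `c` from the vertices of `G` to
`{0, …, k - 1}` such that, for each colour `i`, every component of the subgraph of `G` induced by
the vertices of colour `i` has at most `N` vertices. -/
def ColorableWithClustering {α : Type u} {β : Type v} (G : Graph α β) (k N : ℕ) : Prop :=
  ∃ c : α → ℕ, (∀ x ∈ G.vertexSet, c x < k) ∧
    ∀ i < k, ∀ x ∈ G.vertexSet, c x = i →
      ((G.induce {y | y ∈ G.vertexSet ∧ c y = i}).componentAt x).encard ≤ N

/-- A tree-decomposition of `G` whose tree has node set `ι`. -/
structure TreeDecomposition {α : Type u} {β : Type v} (G : Graph α β) (ι : Type w) where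
  /-- The tree. -/
  tree : SimpleGraph ι
  isTree : tree.IsTree
  /-- The bag at each node of the tree. -/
  bag : ι → Set α
  iUnion_bag : ⋃ t, bag t = G.vertexSet
  exists_bag_of_isLink : ∀ e x y, G.IsLink e x y → ∃ t, x ∈ bag t ∧ y ∈ bag t
  connected : ∀ x ∈ G.vertexSet, (tree.induce {t | x ∈ bag t}).Connected

namespace TreeDecomposition

/-- The adhesion: the maximum of `|X_t ∩ X_t'|` over all edges `tt'` of the tree
(it is `0` if the tree has no edge). -/
noncomputable def adhesion {α : Type u} {β : Type v} {G : Graph α β} {ι : Type w}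
    (D : G.TreeDecomposition ι) : ℕ∞ :=
  ⨆ (t : ι) (t' : ι) (_ : D.tree.Adj t t'), (D.bag t ∩ D.bag t').encard

/-- The torso at `t`: the graph obtained from `G[X_t]` by adding, for each neighbour `t'` of `t`,
edges that make `X_t ∩ X_t'` a clique. The edges `Sum.inl e` are those of `G[X_t]`; the edges
`Sum.inr s(x, y)` are new and join those pairs of distinct vertices `x, y` of some `X_t ∩ X_t'`
that are not adjacent in `G`. -/
def torso {α : Type u} {β : Type v} {G : Graph α β} {ι : Type w}
    (D : G.TreeDecomposition ι) (t : ι) : Graph α (β ⊕ Sym2 α) where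
  vertexSet := D.bag t
  IsLink f x y :=
    (∃ e, f = Sum.inl e ∧ (G.induce (D.bag t)).IsLink e x y) ∨
    (f = Sum.inr s(x, y) ∧ x ≠ y ∧ ¬ G.Adj x y ∧
      ∃ t', D.tree.Adj t t' ∧ x ∈ D.bag t ∩ D.bag t' ∧ y ∈ D.bag t ∩ D.bag t')
  isLink_symm := by
    rintro f -
    refine ⟨?_⟩
    rintro x y (⟨e, rfl, h⟩ | ⟨rfl, hne, hadj, t', ht, hx, hy⟩)
    · exact Or.inl ⟨e, rfl, h.symm⟩
    · exact Or.inr ⟨by rw [Sym2.eq_swap], hne.symm, fun h => hadj h.symm, t', ht, hy, hx⟩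
  eq_or_eq_of_isLink_of_isLink := by
    rintro f x y z z' (⟨e, rfl, h⟩ | ⟨rfl, -⟩) (⟨e', he, h'⟩ | ⟨he, -⟩)
    · obtain rfl := Sum.inl.inj he
      exact h.left_eq_or_eq h'
    · cases he
    · cases he
    · rcases Sym2.eq_iff.1 (Sum.inr.inj he) with h | h
      · exact Or.inl h.1
      · exact Or.inr h.1
  left_mem_of_isLink := by
    rintro f x y (⟨e, -, h⟩ | ⟨-, -, -, t', -, hx, -⟩)
    · exact h.left_mem
    · exact hx.1

end TreeDecomposition

end Graph

/-! Only colour `0` ever has to be clustered in the torsos; the other colours need only be clustered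
in the bags. For the second claim, shifting the bag colours by one leaves colour `0` unused in the
bags, so both claims follow from one gluing theorem.

Root the tree and induct on meet-closed sets `C` of nodes whose bags meet the rest in a set `S` of
at most `2 * η` vertices. A guard is imposed around `S`: its neighbours get colour `0`, and their
further neighbours get a nonzero colour. Thus no nonzero colour crosses the boundary, and colour `0`
enters by only one layer.

The guard is bounded because degrees are, so a bounded meet-closed set `Z` of nodes covers it. With
`Y` the union of the bags at `Z`, the nodes outside `Z` form pieces. Meet-closedness lets each piece
leave along at most two tree edges, hence attach to `Y` in at most `2 * η` vertices
(`encard_attachment_le`), and the induction colours it with its own guard. Outside the guard,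
vertices of `Y` take their bag colours.

Except for a bounded set of vertices (`exists_exceptional`), each vertex of `Y` lies in one bag at
`Z`, and each piece attaches inside one adhesion set, a clique of the torso at one node of `Z`. A
colour `0` path that passes through a piece is therefore replaced by a torso edge, and a component
meeting `Y` is a torso component, plus the first layers of pieces, plus the effect of the
exceptional set. The bound does not depend on the recursion depth, since components either stay
inside a piece or avoid everything behind its first layer (`encard_relComponent_le_of_pieces`). -/

open Relation Set

namespace Graph

/-! ### Components of a relation inside a set -/

section Components

variable {α : Type u} {R R' : α → α → Prop} {A A' : Set α}

/-- The points that can be reached from `x` along `R`-steps inside `A`. -/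
def relComponent (R : α → α → Prop) (A : Set α) (x : α) : Set α :=
  {y | ReflTransGen (fun a b => R a b ∧ a ∈ A ∧ b ∈ A) x y}

theorem mem_relComponent_self (x : α) : x ∈ relComponent R A x := ReflTransGen.refl

/-- The confinement principle used throughout: an invariant `A'` preserved by steps inside `A` traps
the component, and the steps may be reread in another relation `R'`. -/
theorem relComponent_subset_inter {x : α} (hx : x ∈ A')
    (h : ∀ a ∈ A', ∀ b ∈ A, a ∈ A → R a b → R' a b ∧ b ∈ A') :
    relComponent R A x ⊆ relComponent R' A' x ∩ A' := by
  intro y hy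
  induction hy with
  | refl => exact ⟨ReflTransGen.refl, hx⟩
  | tail _ hbc ih =>
    obtain ⟨h1, h2⟩ := h _ ih.2 _ hbc.2.2 hbc.2.1 hbc.1
    exact ⟨ih.1.tail ⟨h1, ih.2, h2⟩, h2⟩

theorem relComponent_mono (h : A ⊆ A') (x : α) : relComponent R A x ⊆ relComponent R A' x :=
  fun _ hy => ReflTransGen.mono (fun _ _ hab => ⟨hab.1, h hab.2.1, h hab.2.2⟩) _ _ hy

/-- This convention lets bounds be stated for all points, at the price of requiring them to be at
least `1`. -/
theorem relComponent_of_notMem {x : α} (hx : x ∉ A) : relComponent R A x = {x} := by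
  refine Subset.antisymm (fun y hy => ?_) (by simpa using mem_relComponent_self x)
  induction hy with
  | refl => rfl
  | tail _ hbc ih => exact absurd (ih ▸ hbc.2.1) hx

theorem relComponent_subset_of_mem {x : α} (hx : x ∈ A) : relComponent R A x ⊆ A := by
  intro y hy
  induction hy with
  | refl => exact hx
  | tail _ hbc _ => exact hbc.2.2

theorem encard_biUnion_le_mul {β : Type v} {s : Set β} {f : β → Set α} {m n : ℕ}
    (hs : s.encard ≤ m) (hf : ∀ b ∈ s, (f b).encard ≤ n) :
    (⋃ b ∈ s, f b).encard ≤ (m * n : ℕ) := by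
  have hfin : s.Finite := finite_of_encard_le_coe hs
  rw [hfin.encard_eq_coe_toFinset_card, Nat.cast_le] at hs
  have h1 : (⋃ b ∈ hfin.toFinset, f b).encard ≤ ∑ b ∈ hfin.toFinset, (f b).encard :=
    Finset.set_encard_biUnion_le _ _
  have h2 : ∑ b ∈ hfin.toFinset, (f b).encard ≤ ∑ _b ∈ hfin.toFinset, (n : ℕ∞) :=
    Finset.sum_le_sum fun b hb => hf b (by simpa using hb)
  simp only [Finite.mem_toFinset] at h1
  refine h1.trans (h2.trans ?_)
  rw [Finset.sum_const, nsmul_eq_mul]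
  exact_mod_cast Nat.mul_le_mul_right n hs

/-- The bound for the size of components after adding `b` points of degree at most `d` to a set
whose components have at most `M` points. -/
def addPointsBound (d b M : ℕ) : ℕ := b + (M + b * (d * M))

theorem addPointsBound_mono {d b b' M M' : ℕ} (hb : b ≤ b') (hM : M ≤ M') :
    addPointsBound d b M ≤ addPointsBound d b' M' := by
  unfold addPointsBound
  gcongr

/-- A vertex of the component is in `B`, or is reached while avoiding `B`, or lies in the `A \
B`-component of a neighbour of the last visited vertex of `B`. There are at most `b * d` such
neighbours. -/
theorem encard_relComponent_le_addPointsBound {B : Set α} {d b M : ℕ} (hB : B.encard ≤ b)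
    (hd : ∀ x, {y | R x y}.encard ≤ d)
    (hM : ∀ x, (relComponent R (A \ B) x).encard ≤ M) (x : α) :
    (relComponent R A x).encard ≤ addPointsBound d b M := by
  have key : relComponent R A x ⊆ B ∪ (relComponent R (A \ B) x ∪
      ⋃ z ∈ B, ⋃ y ∈ {y | R z y}, relComponent R (A \ B) y) := by
    intro y hy
    induction hy with
    | refl => exact Or.inr (Or.inl ReflTransGen.refl)
    | @tail p q _ hpq ih =>
      by_cases hq : q ∈ B
      · exact Or.inl hq
      refine Or.inr ?_
      by_cases hp : p ∈ B
      · refine Or.inr (mem_biUnion hp (mem_biUnion (show q ∈ {y | R p y} from hpq.1) ?_))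
        exact ReflTransGen.refl
      · have hstep : R p q ∧ p ∈ A \ B ∧ q ∈ A \ B := ⟨hpq.1, ⟨hpq.2.1, hp⟩, hpq.2.2, hq⟩
        rcases ih with h | h | h
        · exact absurd h hp
        · exact Or.inl (ReflTransGen.tail h hstep)
        · right
          simp only [mem_iUnion] at h ⊢
          obtain ⟨z, hz, y, hy, h⟩ := h
          exact ⟨z, hz, y, hy, ReflTransGen.tail h hstep⟩
  refine (encard_le_encard key).trans ((encard_union_le _ _).trans ?_)
  unfold addPointsBound
  push_cast
  refine add_le_add hB ((encard_union_le _ _).trans (add_le_add (hM x) ?_))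
  have := encard_biUnion_le_mul (f := fun z => ⋃ y ∈ {y | R z y}, relComponent R (A \ B) y) hB
    (n := d * M) fun z _ => encard_biUnion_le_mul (hd z) fun y _ => hM y
  exact_mod_cast this

end Components

/-! ### Rooted trees as meet-semilattices -/

section Rooting

variable {ι : Type w} {T : SimpleGraph ι}

open SimpleGraph in
/-- In a tree with root `r`, every vertex has a parent. -/
theorem _root_.SimpleGraph.IsTree.exists_parent (hT : T.IsTree) (r : ι) :
    ∃ par : ι → ι, par r = r ∧ (∀ v, v ≠ r → T.Adj v (par v) ∧ T.dist r v = T.dist r (par v) + 1) ∧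
      ∀ v w, T.Adj v w → par v = w ∨ par w = v := by
  choose p hp hlen using fun v => (hT.connected r v).exists_path_of_dist
  -- A neighbour closer to the root must be the penultimate vertex of the path from the root;
  -- otherwise the path to `w` would extend the path to `v` and be longer.
  have hpar : ∀ v w, T.Adj v w → T.dist r v = T.dist r w + 1 → w = (p v).penultimate := by
    intro v w hvw hd
    refine hT.isAcyclic.eq_penultimate_of_adj_end (hp v) hvw ?_
    by_contra hw
    have hv : v ∈ (p w).support :=
      hT.isAcyclic.mem_support_of_ne_mem_support_of_adj_of_isPath (hp w) (hp v) hvw.symm hw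
    have h := congrArg Walk.length (hT.isAcyclic.path_concat (hp v) (hp w) hvw hv)
    rw [Walk.length_concat, hlen, hlen] at h
    omega
  refine ⟨fun v => (p v).penultimate, ?_, ?_, ?_⟩
  · have : (p r).Nil := Walk.length_eq_zero_iff.1 (by rw [hlen]; simp)
    simp [this.eq_nil]
  · intro v hv
    have hnil : ¬ (p v).Nil := fun h => hv h.eq.symm
    have hadj : T.Adj v (p v).penultimate := ((p v).adj_penultimate hnil).symm
    refine ⟨hadj, ?_⟩
    rcases hT.dist_eq_dist_add_one_of_adj r hadj with h | h
    · exact h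
    · exfalso
      have h1 : T.dist r (p v).penultimate ≤ (p v).dropLast.length := dist_le _
      have h2 := hlen v
      have h3 : (p v).dropLast.length ≤ (p v).length := by simp
      omega
  · intro v w hvw
    rcases hT.dist_eq_dist_add_one_of_adj r hvw with h | h
    · exact Or.inl (hpar v w hvw h).symm
    · exact Or.inr (hpar w v hvw.symm h).symm

/-- A meet-semilattice is a rooted forest order with parent function `par` if the elements below
an element form a chain and `par v` is the largest element strictly below `v`. -/
structure IsParentFunction [SemilatticeInf ι] (par : ι → ι) : Prop where
  total : ∀ {a b c : ι}, a ≤ c → b ≤ c → a ≤ b ∨ b ≤ a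
  le_par : ∀ {a b : ι}, a < b → a ≤ par b
  par_le : ∀ a : ι, par a ≤ a
  par_lt : ∀ {a b : ι}, ¬ b ≤ a → par b < b

/-- The order is ancestry, that is, iteration of `par`; antisymmetry comes from the distance to the
root. The root is below everything, so `¬ v ≤ w` certifies that `v` is not the root without naming
it. -/
theorem _root_.SimpleGraph.IsTree.exists_isParentFunction (hT : T.IsTree) :
    ∃ (_ : SemilatticeInf ι) (par : ι → ι), IsParentFunction par ∧
      (∀ v w : ι, ¬ v ≤ w → T.Adj v (par v)) ∧
      ∀ v w, T.Adj v w → par v = w ∨ par w = v := by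
  obtain ⟨r⟩ := hT.connected.nonempty
  obtain ⟨par, hr, hpar, hadj⟩ := hT.exists_parent r
  have hiter : ∀ n v, T.dist r (par^[n] v) ≤ T.dist r v ∧
      (T.dist r (par^[n] v) = T.dist r v → par^[n] v = v) := by
    intro n
    induction n with
    | zero => simp
    | succ n ih =>
      intro v
      rw [Function.iterate_succ_apply]
      by_cases hv : v = r
      · rw [hv, hr]; exact ih r
      · have h1 := (hpar v hv).2
        have h2 := ih (par v)
        exact ⟨by omega, fun h => by omega⟩
  have hroot : ∀ n v, T.dist r v ≤ n → par^[n] v = r := by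
    intro n
    induction n with
    | zero =>
      intro v hv
      have := (hT.connected.dist_eq_zero_iff (u := r) (v := v)).1 (by omega)
      simp [this]
    | succ n ih =>
      intro v hv
      rw [Function.iterate_succ_apply]
      by_cases h : v = r
      · rw [h, hr]; exact ih r (by simp)
      · have := (hpar v h).2
        exact ih _ (by omega)
  let P : PartialOrder ι :=
    { le := fun a b => ∃ n, par^[n] b = a
      le_refl := fun a => ⟨0, rfl⟩
      le_trans := by
        rintro a b c ⟨m, rfl⟩ ⟨n, rfl⟩
        exact ⟨m + n, Function.iterate_add_apply _ _ _ _⟩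
      le_antisymm := by
        rintro a b ⟨m, rfl⟩ ⟨n, h⟩
        have h1 := hiter m b
        have h2 := (hiter n (par^[m] b)).1
        rw [h] at h2
        exact h1.2 (by omega) }
  have hle : ∀ {a b : ι}, a ≤ b ↔ ∃ n, par^[n] b = a := Iff.rfl
  have htotal : ∀ {a b c : ι}, a ≤ c → b ≤ c → a ≤ b ∨ b ≤ a := by
    rintro a b c ⟨m, rfl⟩ ⟨n, rfl⟩
    rcases le_total m n with h | h
    · obtain ⟨l, rfl⟩ := Nat.exists_eq_add_of_le h
      exact Or.inr ⟨l, by rw [← Function.iterate_add_apply, add_comm]⟩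
    · obtain ⟨l, rfl⟩ := Nat.exists_eq_add_of_le h
      exact Or.inl ⟨l, by rw [← Function.iterate_add_apply, add_comm]⟩
  have hrle : ∀ a : ι, r ≤ a := fun a => ⟨_, hroot _ a le_rfl⟩
  have hlepar : ∀ {a b : ι}, a < b → a ≤ par b := by
    intro a b hab
    obtain ⟨n, hn⟩ := hab.le
    cases n with
    | zero => exact absurd hn.symm hab.ne
    | succ n => exact ⟨n, by rwa [Function.iterate_succ_apply] at hn⟩
  have hparle : ∀ a : ι, par a ≤ a := fun a => ⟨1, rfl⟩
  have hparlt : ∀ {a : ι}, a ≠ r → par a < a := by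
    intro a ha
    refine lt_of_le_of_ne (hparle a) fun h => ?_
    have := (hpar a ha).2
    rw [h] at this
    omega
  have hinf : ∀ a b : ι, ∃ c, c ≤ a ∧ c ≤ b ∧ ∀ e, e ≤ a → e ≤ b → e ≤ c := by
    intro a b
    have hex : ∃ n, par^[n] a ≤ b := ⟨_, (hroot _ a le_rfl).symm ▸ hrle b⟩
    classical
    -- The meet is the first ancestor of `a` that is also an ancestor of `b`.
    refine ⟨par^[Nat.find hex] a, ⟨_, rfl⟩, Nat.find_spec hex, ?_⟩
    rintro e ⟨n, rfl⟩ heb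
    obtain ⟨l, rfl⟩ := Nat.exists_eq_add_of_le (Nat.find_min' hex heb)
    exact ⟨l, by rw [← Function.iterate_add_apply, add_comm]⟩
  choose meet h1 h2 h3 using hinf
  let L : SemilatticeInf ι :=
    { P with
      inf := meet
      inf_le_left := h1
      inf_le_right := h2
      le_inf := fun e a b ha hb => h3 a b e ha hb }
  refine ⟨L, par, ⟨htotal, hlepar, hparle, fun {a b} h => hparlt ?_⟩,
    fun v w h => (hpar v ?_).1, hadj⟩
  · rintro rfl; exact h (hrle a)
  · rintro rfl; exact h (hrle w)

end Rooting

/-! ### Gluing guarded colourings -/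

section Gluing

variable {α : Type u} {ι : Type w} {J : Type v} {Adj : α → α → Prop}

/-- A colouring of `I` that uses colour `0` on the neighbours of `S`, avoids colour `0` on their
other neighbours, and whose monochromatic components in `I` have at most `M` vertices. -/
structure IsGuardedColoring (Adj : α → α → Prop) (I S : Set α) (M : ℕ) (c : α → ℕ) : Prop where
  eq_zero : ∀ x ∈ I, (∃ s ∈ S, Adj s x) → c x = 0
  ne_zero : ∀ x ∈ I, (¬ ∃ s ∈ S, Adj s x) → ∀ y ∈ I, (∃ s ∈ S, Adj s y) → Adj y x → c x ≠ 0
  encard_le : ∀ i x, (relComponent Adj {y ∈ I | c y = i} x).encard ≤ M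

theorem IsGuardedColoring.congr {I S : Set α} {M : ℕ} {c c' : α → ℕ}
    (h : IsGuardedColoring Adj I S M c) (hc : ∀ x ∈ I, c' x = c x) :
    IsGuardedColoring Adj I S M c' where
  eq_zero x hx hs := (hc x hx).trans (h.eq_zero x hx hs)
  ne_zero x hx hs y hy hsy hyx := by
    rw [hc x hx]
    exact h.ne_zero x hx hs y hy hsy hyx
  encard_le i x := by
    have : {y ∈ I | c' y = i} = {y ∈ I | c y = i} :=
      Set.ext fun y => and_congr_right fun hy => by rw [hc y hy]
    rw [this]
    exact h.encard_le i x

/-- Guarded colourings of the pieces `V j \ Y`, which attach to the rest through `V j ∩ Y`, combine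
with a colouring of `Y` that agrees with clustered colourings of the bags `X t` outside the
bounded set `B`. -/
theorem encard_relComponent_le_of_pieces {d s b N M : ℕ} {Y S B : Set α} {V : J → Set α}
    {c : α → ℕ} {z : α → ι} {X : ι → Set α} {f : ι → α → ℕ} {R : ι → α → α → Prop}
    (hsymm : ∀ a b, Adj a b → Adj b a) (hd : ∀ x, {y | Adj x y}.encard ≤ d)
    (hB : B.encard ≤ b)
    (hadj : ∀ j x y, x ∈ V j → x ∉ Y → Adj x y → y ∈ V j)
    (hcard : ∀ j, (V j ∩ Y).encard ≤ s)
    (hc : ∀ j, IsGuardedColoring Adj (V j \ Y) (V j ∩ Y) M c)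
    (hz : ∀ x ∈ Y \ B, x ∈ X (z x) ∧ c x = f (z x) x)
    (hzadj : ∀ x ∈ Y \ B, ∀ y ∈ Y \ B, Adj x y → z x = z y)
    (hzR : ∀ j, ∀ x ∈ Y \ B, ∀ y ∈ Y \ B, x ∈ V j → y ∈ V j → z x = z y ∧ R (z x) x y)
    (hR : ∀ t x y, Adj x y → R t x y)
    (hf : ∀ i x t, i ≠ 0 → (relComponent Adj {y ∈ X t | f t y = i} x).encard ≤ N)
    (hf0 : ∀ x t, (relComponent (R t) {y ∈ X t | f t y = 0} x).encard ≤ N) (hN : 1 ≤ N)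
    (hM : addPointsBound d b (addPointsBound d N (s * d + 1)) ≤ M) (i : ℕ) (x : α) :
    (relComponent Adj {y ∈ (Y ∪ ⋃ j, V j) \ S | c y = i} x).encard ≤ M := by
  set A := {y ∈ (Y ∪ ⋃ j, V j) \ S | c y = i} with hA
  have hNM : N ≤ addPointsBound d N (s * d + 1) := by unfold addPointsBound; omega
  have h1M : 1 ≤ M := by
    refine le_trans ?_ hM
    unfold addPointsBound; omega
  have hcases : ∀ y ∈ A, y ∈ Y ∨ ∃ j, y ∈ V j ∧ y ∉ Y := by
    rintro y ⟨⟨hy | hy, -⟩, -⟩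
    · exact Or.inl hy
    · by_cases hyY : y ∈ Y
      · exact Or.inl hyY
      · obtain ⟨j, hj⟩ := mem_iUnion.1 hy
        exact Or.inr ⟨j, hj, hyY⟩
  have hsingle : x ∉ A → (relComponent Adj A x).encard ≤ M := by
    intro hx
    rw [relComponent_of_notMem hx, encard_singleton]
    exact_mod_cast h1M
  by_cases hxA : x ∉ A
  · exact hsingle hxA
  rw [not_not] at hxA
  by_cases hi : i = 0
  · -- colour `0` may pass from `Y` to the vertices of the pieces that are adjacent to `Y`
    let L : J → Set α := fun j => {y ∈ V j \ Y | ∃ a ∈ V j ∩ Y, Adj a y}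
    -- The `+ 1` keeps the bound positive for singleton components of points outside the set.
    have hL : ∀ j, (L j).encard ≤ (s * d + 1 : ℕ) := by
      intro j
      have h1 : L j ⊆ ⋃ a ∈ V j ∩ Y, {y | Adj a y} := by
        rintro y ⟨-, a, ha, hay⟩
        exact mem_biUnion ha hay
      refine (encard_le_encard h1).trans ((encard_biUnion_le_mul (hcard j) fun a _ => hd a).trans ?_)
      exact_mod_cast Nat.le_succ _
    -- Behind the first layer `L j`, a vertex of colour `0` has no neighbour in `L j`, by the guard;
    -- so colour `0` components there never come out.
    have hclosed : ∀ j, ∀ a ∈ A, ∀ e ∈ A, a ∈ V j → a ∉ Y → a ∉ L j → Adj a e →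
        e ∈ V j ∧ e ∉ Y ∧ e ∉ L j := by
      intro j a ha e he haj haY haL hae
      have hej := hadj j a e haj haY hae
      have heY : e ∉ Y := fun heY => haL ⟨⟨haj, haY⟩, e, ⟨hej, heY⟩, hsymm _ _ hae⟩
      refine ⟨hej, heY, fun heL => ?_⟩
      exact (hc j).ne_zero a ⟨haj, haY⟩ (fun h => haL ⟨⟨haj, haY⟩, h⟩) e ⟨hej, heY⟩ heL.2
        (hsymm _ _ hae) (ha.2.trans hi)
    by_cases hxI : ∃ j, x ∈ V j ∧ x ∉ Y ∧ x ∉ L j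
    · obtain ⟨j, hxj, hxY, hxL⟩ := hxI
      have h1 : relComponent Adj A x ⊆
          relComponent Adj {y ∈ A | y ∈ V j ∧ y ∉ Y ∧ y ∉ L j} x := by
        refine (relComponent_subset_inter
          (A' := {y ∈ A | y ∈ V j ∧ y ∉ Y ∧ y ∉ L j}) ⟨hxA, hxj, hxY, hxL⟩ ?_).trans inter_subset_left
        rintro a ⟨ha, haj, haY, haL⟩ e he - hae
        exact ⟨hae, he, hclosed j a ha e he haj haY haL hae⟩
      refine (encard_le_encard (h1.trans (relComponent_mono ?_ x))).trans ((hc j).encard_le i x)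
      rintro y ⟨hyA, hyj, hyY, -⟩
      exact ⟨⟨hyj, hyY⟩, hyA.2⟩
    · set A' := {y ∈ A | ¬ ∃ j, y ∈ V j ∧ y ∉ Y ∧ y ∉ L j} with hA'
      have h1 : relComponent Adj A x ⊆ relComponent Adj A' x := by
        refine (relComponent_subset_inter (A' := A') ⟨hxA, hxI⟩ ?_).trans inter_subset_left
        rintro a ⟨ha, haI⟩ e he - hae
        refine ⟨hae, he, ?_⟩
        rintro ⟨j, hej, heY, heL⟩
        exact haI ⟨j, hclosed j e he a ha hej heY heL (hsymm _ _ hae)⟩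
      have hA'L : ∀ y ∈ A', ∀ j, y ∈ V j → y ∉ Y → y ∈ L j := by
        rintro y ⟨-, hy⟩ j hyj hyY
        by_contra hyL
        exact hy ⟨j, hyj, hyY, hyL⟩
      -- Add points twice: first restore `B`, then, within a component `K` avoiding `B`, restore the
      -- at most `N` vertices of `K ∩ Y`. What is left lies in single layers `L j`.
      refine (encard_le_encard h1).trans ((encard_relComponent_le_addPointsBound hB hd
        (M := addPointsBound d N (s * d + 1)) (fun w => ?_) x).trans (by exact_mod_cast hM))
      by_cases hw : w ∉ A' \ B
      · rw [relComponent_of_notMem hw, encard_singleton]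
        exact_mod_cast hN.trans hNM
      rw [not_not] at hw
      set K := relComponent Adj (A' \ B) w with hK
      have hKsub : K ⊆ A' \ B := relComponent_subset_of_mem hw
      have hKclosed : ∀ a ∈ K, ∀ e ∈ A' \ B, Adj a e → e ∈ K := fun a ha e he hae =>
        ReflTransGen.tail ha ⟨hae, hKsub ha, he⟩
      have hKK : K ⊆ relComponent Adj K w := by
        refine (relComponent_subset_inter (A' := K) (mem_relComponent_self w) ?_).trans
          inter_subset_left
        exact fun a ha e he _ hae => ⟨hae, hKclosed a ha e he hae⟩
      have hKY : (K ∩ Y).encard ≤ N := by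
        rcases (K ∩ Y).eq_empty_or_nonempty with h | ⟨y₀, hy₀K, hy₀Y⟩
        · simp [h]
        have hy₀ := hz y₀ ⟨hy₀Y, (hKsub hy₀K).2⟩
        set t := z y₀ with ht
        set F := {y ∈ X t | f t y = 0} with hF
        have hmem : ∀ y, y ∈ Y → y ∈ A' → y ∉ B → z y = t → y ∈ F := by
          intro y hyY hyA' hyB hyz
          have := hz y ⟨hyY, hyB⟩
          rw [hyz] at this
          exact ⟨this.1, this.2.symm.trans (hyA'.1.2.trans hi)⟩
        have hback : ∀ y ∈ K, w ∈ relComponent Adj (A' \ B) y := by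
          intro y hy
          induction hy with
          | refl => exact ReflTransGen.refl
          | tail _ h ih => exact ReflTransGen.head ⟨hsymm _ _ h.1, h.2.2, h.2.1⟩ ih
        have hKy₀ : ∀ y ∈ K, y ∈ relComponent Adj (A' \ B) y₀ :=
          fun y hy => ReflTransGen.trans (hback y₀ hy₀K) hy
        -- While the path is inside a piece, remember a vertex `a` of `Y` attached to that piece and
        -- already reached in `R t`; on returning to `Y` at `q`, `hzR` supplies the step from `a` to
        -- `q`.
        have hinv : ∀ y ∈ relComponent Adj (A' \ B) y₀,
            (y ∈ Y ∧ z y = t ∧ y ∈ relComponent (R t) F y₀) ∨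
            (∃ j, y ∈ V j ∧ y ∉ Y ∧ ∃ a ∈ V j, a ∈ Y ∧ a ∈ A' ∧ a ∉ B ∧ z a = t ∧
              a ∈ relComponent (R t) F y₀) := by
          intro y hy
          induction hy with
          | refl => exact Or.inl ⟨hy₀Y, rfl, ReflTransGen.refl⟩
          | @tail p q _ hpq ih =>
            obtain ⟨hadjpq, hp, hq⟩ := hpq
            rcases ih with ⟨hpY, hpz, hpF⟩ | ⟨j, hpj, hpY, a, haj, haY, haA, haB, haz, haF⟩
            · by_cases hqY : q ∈ Y
              · have hqz : z q = t := (hzadj p ⟨hpY, hp.2⟩ q ⟨hqY, hq.2⟩ hadjpq).symm.trans hpz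
                exact Or.inl ⟨hqY, hqz, ReflTransGen.tail hpF ⟨hR t _ _ hadjpq,
                  hmem p hpY hp.1 hp.2 hpz, hmem q hqY hq.1 hq.2 hqz⟩⟩
              · obtain ⟨j, hqj, -⟩ := (hcases q hq.1.1).resolve_left hqY
                exact Or.inr ⟨j, hqj, hqY, p, hadj j q p hqj hqY (hsymm _ _ hadjpq), hpY, hp.1,
                  hp.2, hpz, hpF⟩
            · have hqj := hadj j p q hpj hpY hadjpq
              by_cases hqY : q ∈ Y
              · obtain ⟨h1, h2⟩ := hzR j a ⟨haY, haB⟩ q ⟨hqY, hq.2⟩ haj hqj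
                have hqz := h1.symm.trans haz
                rw [haz] at h2
                exact Or.inl ⟨hqY, hqz, ReflTransGen.tail haF ⟨h2, hmem a haY haA haB haz,
                  hmem q hqY hq.1 hq.2 hqz⟩⟩
              · exact Or.inr ⟨j, hqj, hqY, a, haj, haY, haA, haB, haz, haF⟩
        refine (encard_le_encard ?_).trans (hf0 y₀ t)
        rintro y ⟨hyK, hyY⟩
        rcases hinv y (hKy₀ y hyK) with h | ⟨j, -, hyY', -⟩
        · exact h.2.2
        · exact absurd hyY hyY'
      refine (encard_le_encard hKK).trans
        (encard_relComponent_le_addPointsBound hKY hd (fun y => ?_) w)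
      by_cases hy : y ∉ K \ (K ∩ Y)
      · rw [relComponent_of_notMem hy, encard_singleton]
        exact_mod_cast Nat.succ_le_succ (Nat.zero_le _)
      rw [not_not] at hy
      have hyY : y ∉ Y := fun h => hy.2 ⟨hy.1, h⟩
      obtain ⟨j, hyj, -⟩ := (hcases y (hKsub hy.1).1.1).resolve_left hyY
      refine (encard_le_encard ?_).trans (hL j)
      refine (relComponent_subset_inter (R' := Adj) (A' := L j)
        (hA'L y (hKsub hy.1).1 j hyj hyY) ?_).trans inter_subset_right
      rintro a haL e ⟨heK, heY⟩ - hae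
      exact ⟨hae, hA'L e (hKsub heK).1 j (hadj j a e haL.1.1 haL.1.2 hae)
        fun h => heY ⟨heK, h⟩⟩
  · -- a nonzero colour cannot pass between `Y` and the pieces
    have hsep : ∀ j, ∀ a ∈ A, ∀ e ∈ A, a ∈ V j → a ∉ Y → Adj a e → e ∈ V j ∧ e ∉ Y := by
      intro j a ha e he haj haY hae
      have hej := hadj j a e haj haY hae
      refine ⟨hej, fun heY => hi ?_⟩
      exact ha.2.symm.trans ((hc j).eq_zero a ⟨haj, haY⟩ ⟨e, ⟨hej, heY⟩, hsymm _ _ hae⟩)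
    rcases hcases x hxA with hxY | ⟨j, hxj, hxY⟩
    · have h1 : relComponent Adj A x ⊆ relComponent Adj (A ∩ Y) x := by
        refine (relComponent_subset_inter (A' := A ∩ Y) ⟨hxA, hxY⟩ ?_).trans inter_subset_left
        rintro a ⟨ha, haY⟩ e he - hae
        refine ⟨hae, he, ?_⟩
        by_contra heY
        obtain ⟨j, hej, -⟩ := (hcases e he).resolve_left heY
        exact (hsep j e he a ha hej heY (hsymm _ _ hae)).2 haY
      refine (encard_le_encard h1).trans ((encard_relComponent_le_addPointsBound hB hd
        (fun w => ?_) x).trans (by exact_mod_cast (addPointsBound_mono le_rfl hNM).trans hM))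
      by_cases hw : w ∉ (A ∩ Y) \ B
      · rw [relComponent_of_notMem hw, encard_singleton]
        exact_mod_cast hN
      rw [not_not] at hw
      have hw' := hz w ⟨hw.1.2, hw.2⟩
      refine (encard_le_encard ?_).trans (hf i w (z w) hi)
      refine ((relComponent_subset_inter (R' := Adj)
        (A' := {y ∈ X (z w) | f (z w) y = i} ∩ {y | y ∈ (A ∩ Y) \ B ∧ z y = z w})
        ⟨⟨hw'.1, hw'.2.symm.trans hw.1.1.2⟩, hw, rfl⟩ ?_).trans inter_subset_left).trans
        (relComponent_mono inter_subset_left w)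
      rintro a ⟨-, ha, haz⟩ e he - hae
      have hez : z e = z w := (hzadj a ⟨ha.1.2, ha.2⟩ e ⟨he.1.2, he.2⟩ hae).symm.trans haz
      have := hz e ⟨he.1.2, he.2⟩
      rw [hez] at this
      exact ⟨hae, ⟨this.1, this.2.symm.trans he.1.1.2⟩, he, hez⟩
    · refine (encard_le_encard ?_).trans ((hc j).encard_le i x)
      refine ((relComponent_subset_inter (R' := Adj) (A' := A ∩ (V j \ Y)) ⟨hxA, hxj, hxY⟩
        ?_).trans inter_subset_left).trans (relComponent_mono ?_ x)
      · rintro a ⟨ha, haj, haY⟩ e he - hae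
        exact ⟨hae, he, hsep j a ha e he haj haY hae⟩
      · rintro y ⟨hyA, hy⟩
        exact ⟨hy, hyA.2⟩

end Gluing

/-! ### Unions of bags -/

section BagUnion

variable {α : Type u} {ι : Type w} {X : ι → Set α}

/-- The union of the bags at the nodes in `C`. -/
def bagUnion (X : ι → Set α) (C : Set ι) : Set α := ⋃ t ∈ C, X t

theorem mem_bagUnion {C : Set ι} {x : α} : x ∈ bagUnion X C ↔ ∃ t ∈ C, x ∈ X t := by
  simp [bagUnion]

end BagUnion

/-! ### Pieces, gates and their attachments -/

section RootedDecomposition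

variable {α : Type u} {ι : Type w} [SemilatticeInf ι] {par : ι → ι} {X : ι → Set α} {η : ℕ}

/-- A tree-decomposition of adhesion at most `η` over a rooted tree: `sep` says that the nodes whose
bags contain a given vertex are connected. -/
structure IsRootedDecomposition (par : ι → ι) (X : ι → Set α) (η : ℕ) : Prop
    extends IsParentFunction par where
  sep : ∀ {x : α} {a b c : ι}, x ∈ X a → x ∈ X b → c ≤ a → ¬ c ≤ b → x ∈ X c ∩ X (par c)
  encard_le : ∀ {a b : ι}, ¬ a ≤ b → (X a ∩ X (par a)).encard ≤ η

/-- The nodes of `C` that are separated from `Z` by `u` from below. -/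
def pieceAbove (C Z : Set ι) (u : ι) : Set ι := {t ∈ C | u ≤ t ∧ ∀ v, u ≤ v → v ≤ t → v ∉ Z}

/-- The nodes just above a node of `Z`. -/
def IsGate (par : ι → ι) (Z : Set ι) (u : ι) : Prop := par u ∈ Z ∧ par u < u

theorem exists_least_of_infClosed [Finite ι] {C : Set ι} (hC : InfClosed C) (hne : C.Nonempty) :
    ∃ q ∈ C, ∀ t ∈ C, q ≤ t := by
  obtain ⟨q, hq, hmin⟩ := C.toFinite.exists_minimal hne
  exact ⟨q, hq, fun t ht => (hmin (hC hq ht) inf_le_left).trans inf_le_right⟩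

theorem infClosed_pieceAbove {C Z : Set ι} (hC : InfClosed C) (u : ι) :
    InfClosed (pieceAbove C Z u) := fun _ ha _ hb =>
  ⟨hC ha.1 hb.1, le_inf ha.2.1 hb.2.1, fun v hv hva => ha.2.2 v hv (hva.trans inf_le_left)⟩

/-- Elements below `a` form a chain, so `a ⊓ x ⊓ y` is already `a ⊓ x` or `a ⊓ y`. Pairwise meets
therefore suffice, and the closure has quadratic size. -/
theorem IsParentFunction.infClosed_iUnion_inf (h : IsParentFunction par) (W : Set ι) :
    InfClosed (⋃ a ∈ W, (fun b => a ⊓ b) '' W) := by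
  intro p hp q hq
  simp only [mem_iUnion, mem_image] at hp hq ⊢
  obtain ⟨a, ha, b, hb, rfl⟩ := hp
  obtain ⟨c, hc, e, he, rfl⟩ := hq
  have two : ∀ x ∈ W, ∀ y ∈ W, ∃ w ∈ W, a ⊓ w = a ⊓ x ⊓ y := by
    intro x hx y hy
    rcases h.total (a := a ⊓ x) (b := a ⊓ y) inf_le_left inf_le_left with hxy | hxy
    · exact ⟨x, hx, (inf_eq_left.2 (hxy.trans inf_le_right)).symm⟩
    · refine ⟨y, hy, le_antisymm (le_inf hxy inf_le_right) ?_⟩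
      exact le_inf (inf_le_left.trans inf_le_left) inf_le_right
  obtain ⟨w, hw, hw'⟩ := two b hb c hc
  obtain ⟨w', hw'', hw'''⟩ := two w hw e he
  exact ⟨a, ha, w', hw'', by rw [hw''', hw']; ac_rfl⟩

/-- A bounded set of vertices is covered by a bounded meet-closed set of nodes. -/
theorem IsParentFunction.exists_infClosed_cover [Finite ι] (h : IsParentFunction par) {C : Set ι}
    (hC : InfClosed C) (hne : C.Nonempty) {S : Set α} {m : ℕ} (hS : S ⊆ bagUnion X C)
    (hm : S.encard ≤ m) :
    ∃ Z ⊆ C, InfClosed Z ∧ (∃ c₀ ∈ Z, ∀ t ∈ C, c₀ ≤ t) ∧ S ⊆ bagUnion X Z ∧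
      Z.encard ≤ ((m + 1) * (m + 1) : ℕ) := by
  obtain ⟨c₀, hc₀, hleast⟩ := exists_least_of_infClosed hC hne
  have hnode : ∀ x, ∃ t, x ∈ S → t ∈ C ∧ x ∈ X t := by
    intro x
    by_cases hx : x ∈ S
    · obtain ⟨t, ht, hxt⟩ := mem_bagUnion.1 (hS hx)
      exact ⟨t, fun _ => ⟨ht, hxt⟩⟩
    · exact ⟨c₀, fun h => absurd h hx⟩
  choose node hnode using hnode
  -- Including the least node `c₀` puts every node of `C` above some node of `Z`, and accounts for
  -- `m + 1`.
  set W := insert c₀ (node '' S) with hW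
  have hWC : W ⊆ C := insert_subset hc₀ (by rintro _ ⟨x, hx, rfl⟩; exact (hnode x hx).1)
  have hWcard : W.encard ≤ (m + 1 : ℕ) := by
    refine (encard_insert_le _ _).trans ?_
    push_cast
    gcongr
    exact (encard_image_le _ _).trans hm
  have hWZ : W ⊆ ⋃ a ∈ W, (fun b => a ⊓ b) '' W := fun a ha =>
    mem_biUnion ha ⟨a, ha, inf_idem a⟩
  refine ⟨⋃ a ∈ W, (fun b => a ⊓ b) '' W, ?_, h.infClosed_iUnion_inf W,
    ⟨c₀, hWZ (mem_insert _ _), hleast⟩, fun x hx => ?_, ?_⟩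
  · simp only [iUnion_subset_iff]
    rintro a ha _ ⟨b, hb, rfl⟩
    exact hC (hWC ha) (hWC hb)
  · exact mem_bagUnion.2
      ⟨node x, hWZ (mem_insert_of_mem _ (mem_image_of_mem _ hx)), (hnode x hx).2⟩
  · exact encard_biUnion_le_mul hWcard fun a _ => (encard_image_le _ _).trans hWcard

/-- Descend from `t` as long as `Z` is avoided. The descent stops before `c₀ ∈ Z`, and minimality of
the last node puts its parent in `Z`. -/
theorem IsParentFunction.exists_gate [Finite ι] (h : IsParentFunction par) {C Z : Set ι} {c₀ t : ι}
    (hc₀ : c₀ ∈ Z) (hleast : ∀ t ∈ C, c₀ ≤ t) (ht : t ∈ C) (htZ : t ∉ Z) :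
    ∃ u, IsGate par Z u ∧ t ∈ pieceAbove C Z u := by
  obtain ⟨u, hu, hmin⟩ := (toFinite {u | u ≤ t ∧ ∀ v, u ≤ v → v ≤ t → v ∉ Z}).exists_minimal
    ⟨t, le_rfl, fun v h1 h2 => le_antisymm h2 h1 ▸ htZ⟩
  have hnot : ¬ u ≤ c₀ := fun hle => hu.2 c₀ hle (hleast t ht) hc₀
  have hlt := h.par_lt hnot
  refine ⟨u, ⟨?_, hlt⟩, ht, hu⟩
  by_contra hpar
  refine hlt.not_ge (hmin ⟨hlt.le.trans hu.1, fun v hv hvt hvZ => ?_⟩ hlt.le)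
  rcases h.total hvt hu.1 with hvu | huv
  · rcases hvu.eq_or_lt with rfl | hvu
    · exact hu.2 v le_rfl hvt hvZ
    · exact hpar (le_antisymm (h.le_par hvu) hv ▸ hvZ)
  · exact hu.2 v huv hvt hvZ

theorem IsParentFunction.gate_unique_of_le (h : IsParentFunction par) {C Z : Set ι} {u u' t : ι}
    (hu : IsGate par Z u) (hu' : IsGate par Z u') (ht : t ∈ pieceAbove C Z u) (hle : u' ≤ t)
    (h' : ∀ v, u' ≤ v → v ≤ u → v ∉ Z) : u = u' := by
  rcases h.total ht.2.1 hle with h1 | h1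
  · rcases h1.eq_or_lt with h1 | h1
    · exact h1
    · exact absurd hu'.1 (ht.2.2 _ (h.le_par h1) (hu'.2.le.trans hle))
  · rcases h1.eq_or_lt with h1 | h1
    · exact h1.symm
    · exact absurd hu.1 (h' _ (h.le_par h1) hu.2.le)

/-- Pieces are disjoint outside the bags at `Z`: the nodes containing `x` are connected, so leaving
the part above `u` would put `x` into the bag at `par u ∈ Z`. -/
theorem IsRootedDecomposition.gate_unique (h : IsRootedDecomposition par X η) {C Z : Set ι}
    {u u' : ι} {x : α} (hu : IsGate par Z u) (hu' : IsGate par Z u')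
    (hx : x ∈ bagUnion X (pieceAbove C Z u)) (hx' : x ∈ bagUnion X (pieceAbove C Z u'))
    (hxZ : x ∉ bagUnion X Z) : u = u' := by
  obtain ⟨t, ht, hxt⟩ := mem_bagUnion.1 hx
  obtain ⟨t', ht', hxt'⟩ := mem_bagUnion.1 hx'
  have h1 : u ≤ t' := by
    by_contra hle
    exact hxZ (mem_bagUnion.2 ⟨_, hu.1, (h.sep hxt hxt' ht.2.1 hle).2⟩)
  exact h.gate_unique_of_le hu hu' ht
    (by
      by_contra hle
      exact hxZ (mem_bagUnion.2 ⟨_, hu'.1, (h.sep hxt' hxt ht'.2.1 hle).2⟩))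
    fun v hv hvu => ht'.2.2 v hv (hvu.trans h1)

theorem IsRootedDecomposition.attachment_subset_of_not_le (h : IsRootedDecomposition par X η)
    {C Z : Set ι} {u : ι} (hZ : ∀ q ∈ Z, ¬ u ≤ q) :
    bagUnion X (pieceAbove C Z u) ∩ bagUnion X Z ⊆ X u ∩ X (par u) := by
  rintro x ⟨hx, hx'⟩
  obtain ⟨t, ht, hxt⟩ := mem_bagUnion.1 hx
  obtain ⟨q, hq, hxq⟩ := mem_bagUnion.1 hx'
  exact h.sep hxt hxq ht.2.1 (hZ q hq)

/-- The nodes of `Z` above `u` have a least element `q` because `Z` is meet-closed. Hence every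
attachment vertex lies in the adhesion set below `u` or in the one below `q`. -/
theorem IsRootedDecomposition.encard_attachment_le [Finite ι] (h : IsRootedDecomposition par X η)
    {C Z : Set ι} {u : ι} (hZ : InfClosed Z) (hu : IsGate par Z u) :
    (bagUnion X (pieceAbove C Z u) ∩ bagUnion X Z).encard ≤ (2 * η : ℕ) := by
  have hu' : (X u ∩ X (par u)).encard ≤ η := h.encard_le hu.2.not_ge
  by_cases hq : ∀ q ∈ Z, ¬ u ≤ q
  · refine (encard_le_encard (h.attachment_subset_of_not_le hq)).trans (hu'.trans ?_)
    exact_mod_cast (by omega : η ≤ 2 * η)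
  push Not at hq
  obtain ⟨q, ⟨hqZ, huq⟩, hleast⟩ := exists_least_of_infClosed (C := {q ∈ Z | u ≤ q})
    (fun a ha b hb => ⟨hZ ha.1 hb.1, le_inf ha.2 hb.2⟩) hq
  rcases (bagUnion X (pieceAbove C Z u) ∩ bagUnion X Z).eq_empty_or_nonempty with h0 | ⟨y, hy, -⟩
  · simp [h0]
  obtain ⟨s, hs, -⟩ := mem_bagUnion.1 hy
  have hq' : (X q ∩ X (par q)).encard ≤ η :=
    h.encard_le (b := s) fun hle => hs.2.2 q huq hle hqZ
  have hsub : bagUnion X (pieceAbove C Z u) ∩ bagUnion X Z ⊆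
      (X u ∩ X (par u)) ∪ (X q ∩ X (par q)) := by
    rintro x ⟨hx, hx'⟩
    obtain ⟨t, ht, hxt⟩ := mem_bagUnion.1 hx
    obtain ⟨q', hq'Z, hxq'⟩ := mem_bagUnion.1 hx'
    by_cases huq' : u ≤ q'
    · exact Or.inr (h.sep hxq' hxt (hleast q' ⟨hq'Z, huq'⟩) fun hle => ht.2.2 q huq hle hqZ)
    · exact Or.inl (h.sep hxt hxq' ht.2.1 huq')
  refine (encard_le_encard hsub).trans ((encard_union_le _ _).trans ?_)
  rw [two_mul]
  push_cast
  exact add_le_add hu' hq'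

/-- Outside a bounded set, every vertex of the bags at `Z` lies in only one of these bags, and
every piece attaches to only one of them. -/
theorem IsRootedDecomposition.exists_exceptional [Finite ι] (h : IsRootedDecomposition par X η)
    {Z : Set ι} {n : ℕ} (C : Set ι) (hZ : InfClosed Z) (hn : Z.encard ≤ n) :
    ∃ E : Set α, E.encard ≤ (n * η + n * (2 * η) : ℕ) ∧
      (∀ x ∉ E, ∀ a ∈ Z, ∀ b ∈ Z, x ∈ X a → x ∈ X b → a = b) ∧
      ∀ u, IsGate par Z u → ∀ x ∉ E, x ∈ bagUnion X (pieceAbove C Z u) → x ∈ bagUnion X Z →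
        x ∈ X u ∩ X (par u) := by
  let P : ι → Set α := fun u => bagUnion X (pieceAbove C Z u) ∩ bagUnion X Z
  let U : Set ι := {u | IsGate par Z u ∧ ∃ q ∈ Z, u ≤ q}
  let Q : Set ι := {q ∈ Z | par q < q}
  have hfirst : ∀ u ∈ U, ∃ q ∈ Z, u ≤ q ∧ ∀ q' ∈ Z, u ≤ q' → q ≤ q' := by
    rintro u ⟨-, hq⟩
    obtain ⟨q, hq, hleast⟩ := exists_least_of_infClosed (C := {q ∈ Z | u ≤ q})
      (fun a ha b hb => ⟨hZ ha.1 hb.1, le_inf ha.2 hb.2⟩) hq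
    exact ⟨q, hq.1, hq.2, fun q' h1 h2 => hleast q' ⟨h1, h2⟩⟩
  choose! first hfZ hfle hfleast using hfirst
  have hle : ∀ u ∈ U, ∀ u' ∈ U, first u = first u' → ¬ u < u' := by
    intro u hu u' hu' heq hlt
    have h1 := hfleast u hu _ hu'.1.1 (h.le_par hlt)
    exact (hu'.1.2.trans_le (hfle u' hu')).not_ge (heq ▸ h1)
  -- If `u < u'` had the same first node of `Z` above them, then `par u' ∈ Z` would lie above `u`
  -- and strictly below that node. So at most `n` gates have a node of `Z` above them.
  have hinj : InjOn first U := by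
    intro u hu u' hu' heq
    rcases h.total (hfle u hu) (heq ▸ hfle u' hu') with h1 | h1
    · exact h1.eq_or_lt.resolve_right (hle u hu u' hu' heq)
    · exact (h1.eq_or_lt.resolve_right (hle u' hu' u hu heq.symm)).symm
  have hUcard : U.encard ≤ n := (encard_le_encard_of_injOn hfZ hinj).trans hn
  have hQcard : Q.encard ≤ n := (encard_le_encard (sep_subset _ _)).trans hn
  refine ⟨(⋃ q ∈ Q, X q ∩ X (par q)) ∪ ⋃ u ∈ U, P u, ?_, ?_, ?_⟩
  · refine (encard_union_le _ _).trans ?_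
    rw [Nat.cast_add]
    exact add_le_add (encard_biUnion_le_mul hQcard fun q hq => h.encard_le hq.2.not_ge)
      (encard_biUnion_le_mul hUcard fun u hu => h.encard_attachment_le hZ hu.1)
  · intro x hx a ha b hb hxa hxb
    have key : ∀ a ∈ Z, ∀ b, x ∈ X a → x ∈ X b → a ≤ b := by
      intro a ha b hxa hxb
      by_contra hab
      exact hx (Or.inl (mem_biUnion (show a ∈ Q from ⟨ha, h.par_lt hab⟩)
        (h.sep hxa hxb le_rfl hab)))
    exact le_antisymm (key a ha b hxa hxb) (key b hb a hxb hxa)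
  · intro u hu x hx hxu hxZ
    refine h.attachment_subset_of_not_le (fun q hq huq => hx (Or.inr ?_)) ⟨hxu, hxZ⟩
    exact mem_biUnion (show u ∈ U from ⟨hu, q, hq, huq⟩) ⟨hxu, hxZ⟩

end RootedDecomposition

/-! ### The recursive colouring -/

section Coloring

variable {α : Type u} {ι : Type w} [SemilatticeInf ι] {par : ι → ι} {X : ι → Set α}
  {Adj : α → α → Prop}

/-- Adjacency in the part of the torso at `p` that comes from the children of `p`. -/
def childTorsoRel (Adj : α → α → Prop) (par : ι → ι) (X : ι → Set α) (p : ι) (x y : α) : Prop :=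
  Adj x y ∨ ∃ u, par u = p ∧ par u < u ∧ x ∈ X u ∩ X p ∧ y ∈ X u ∩ X p

/-- The number of vertices at distance at most two from a set of `2 * η` vertices. -/
def guardBound (η d : ℕ) : ℕ := 2 * η + (2 * η * d + 2 * η * d * d)

/-- The bound for the set of vertices whose colours do not come from a single bag. -/
def exceptionBound (η d : ℕ) : ℕ :=
  guardBound η d + ((guardBound η d + 1) * (guardBound η d + 1) * η +
    (guardBound η d + 1) * (guardBound η d + 1) * (2 * η))

/-- The clustering obtained from bag colourings with clustering `N`. -/
def clusteringBound (η d N : ℕ) : ℕ :=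
  addPointsBound d (exceptionBound η d) (addPointsBound d N (2 * η * d + 1))

/-- Induction on the number of nodes of `C`, with a clustering bound independent of `C`. The
hypothesis `hcov` says that edges at vertices outside `S` are seen by the bags of `C`, so `S` really
separates; it passes to the pieces. -/
theorem IsRootedDecomposition.exists_isGuardedColoring [Finite ι] {η d N k : ℕ}
    (h : IsRootedDecomposition par X η) (hsymm : ∀ a b, Adj a b → Adj b a)
    (hd : ∀ x, {y | Adj x y}.encard ≤ d) (hN : 1 ≤ N) (hk : 2 ≤ k) {f : ι → α → ℕ}
    (hfk : ∀ t, ∀ x ∈ X t, f t x < k)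
    (hf : ∀ i x t, i ≠ 0 → (relComponent Adj {y ∈ X t | f t y = i} x).encard ≤ N)
    (hf0 : ∀ x t,
      (relComponent (childTorsoRel Adj par X t) {y ∈ X t | f t y = 0} x).encard ≤ N)
    {C : Set ι} (hC : InfClosed C) {S : Set α} (hS : S ⊆ bagUnion X C)
    (hScard : S.encard ≤ (2 * η : ℕ))
    (hcov : ∀ x ∈ bagUnion X C \ S, ∀ y, Adj x y → ∃ t ∈ C, x ∈ X t ∧ y ∈ X t) :
    ∃ c : α → ℕ, (∀ x ∈ bagUnion X C, c x < k) ∧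
      IsGuardedColoring Adj (bagUnion X C \ S) S (clusteringBound η d N) c := by
  classical
  induction hcard : C.ncard using Nat.strong_induction_on generalizing C S with
  | _ n ih =>
  subst hcard
  rcases C.eq_empty_or_nonempty with rfl | hne
  · have h0 : bagUnion X (∅ : Set ι) = ∅ := by simp [bagUnion]
    refine ⟨fun _ => 0, by simp [h0], ⟨by simp [h0], by simp [h0], fun i x => ?_⟩⟩
    rw [relComponent_of_notMem (by simp [h0]), encard_singleton]
    have : 1 ≤ clusteringBound η d N := by unfold clusteringBound addPointsBound; omega
    exact_mod_cast this
  set N1 := {x ∈ bagUnion X C \ S | ∃ s ∈ S, Adj s x} with hN1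
  set N2 := {x ∈ bagUnion X C \ S | ∃ y ∈ N1, Adj y x} with hN2
  have hG : S ∪ (N1 ∪ N2) ⊆ bagUnion X C :=
    union_subset hS (union_subset (fun x hx => hx.1.1) fun x hx => hx.1.1)
  have hN1card : N1.encard ≤ (2 * η * d : ℕ) := by
    refine (encard_le_encard ?_).trans (encard_biUnion_le_mul hScard fun x _ => hd x)
    rintro x ⟨-, s, hs, hsx⟩
    exact mem_biUnion hs hsx
  have hN2card : N2.encard ≤ (2 * η * d * d : ℕ) := by
    refine (encard_le_encard ?_).trans (encard_biUnion_le_mul hN1card fun x _ => hd x)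
    rintro x ⟨-, s, hs, hsx⟩
    exact mem_biUnion hs hsx
  have hGcard : (S ∪ (N1 ∪ N2)).encard ≤ guardBound η d := by
    refine (encard_union_le _ _).trans ?_
    unfold guardBound
    rw [Nat.cast_add]
    refine add_le_add hScard ((encard_union_le _ _).trans ?_)
    rw [Nat.cast_add]
    exact add_le_add hN1card hN2card
  obtain ⟨Z, hZC, hZ, ⟨c₀, hc₀, hleast⟩, hGZ, hZcard⟩ :=
    h.toIsParentFunction.exists_infClosed_cover hC hne hG hGcard
  obtain ⟨E, hEcard, hE1, hE2⟩ := h.exists_exceptional C hZ hZcard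
  set Y := bagUnion X Z with hY
  let V : {u // IsGate par Z u} → Set α := fun u => bagUnion X (pieceAbove C Z u)
  have hSY : S ⊆ Y := subset_union_left.trans hGZ
  have hunion : ∀ x ∈ bagUnion X C, x ∉ Y → ∃ u, x ∈ V u := by
    intro x hx hxY
    obtain ⟨t, ht, hxt⟩ := mem_bagUnion.1 hx
    obtain ⟨u, hu, htu⟩ := h.exists_gate hc₀ hleast ht
      fun htZ => hxY (mem_bagUnion.2 ⟨t, htZ, hxt⟩)
    exact ⟨⟨u, hu⟩, mem_bagUnion.2 ⟨t, htu, hxt⟩⟩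
  have hVC : ∀ u, V u ⊆ bagUnion X C := fun u x hx => by
    obtain ⟨t, ht, hxt⟩ := mem_bagUnion.1 hx
    exact mem_bagUnion.2 ⟨t, ht.1, hxt⟩
  have hYC : Y ⊆ bagUnion X C := fun x hx => by
    obtain ⟨t, ht, hxt⟩ := mem_bagUnion.1 hx
    exact mem_bagUnion.2 ⟨t, hZC ht, hxt⟩
  have huniq : ∀ u u' x, x ∈ V u → x ∈ V u' → x ∉ Y → u = u' := fun u u' x hx hx' hxY =>
    Subtype.ext (h.gate_unique u.2 u'.2 hx hx' hxY)
  -- edges with an end inside a piece are covered by that piece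
  have hcovV : ∀ u x y, x ∈ V u → x ∉ Y → Adj x y →
      ∃ t ∈ pieceAbove C Z (u : ι), x ∈ X t ∧ y ∈ X t := by
    intro u x y hx hxY hxy
    obtain ⟨t, ht, hxt, hyt⟩ := hcov x ⟨hVC u hx, fun hxS => hxY (hSY hxS)⟩ y hxy
    obtain ⟨u', hu', htu'⟩ := h.exists_gate hc₀ hleast ht
      fun htZ => hxY (mem_bagUnion.2 ⟨t, htZ, hxt⟩)
    have := huniq u ⟨u', hu'⟩ x hx (mem_bagUnion.2 ⟨t, htu', hxt⟩) hxY
    subst this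
    exact ⟨t, htu', hxt, hyt⟩
  have hrec : ∀ u, ∃ c : α → ℕ, (∀ x ∈ V u, c x < k) ∧
      IsGuardedColoring Adj (V u \ Y) (V u ∩ Y) (clusteringBound η d N) c := by
    intro u
    -- The node `c₀` lies in `Z`, hence in no piece.
    have hlt : (pieceAbove C Z (u : ι)).ncard < C.ncard := by
      refine ncard_lt_ncard ⟨fun t ht => ht.1, fun hsub => ?_⟩ C.toFinite
      have := hsub (hZC hc₀)
      exact this.2.2 c₀ this.2.1 le_rfl hc₀
    obtain ⟨c, hck, hc⟩ := ih _ hlt (infClosed_pieceAbove hC (u : ι)) (S := V u ∩ Y)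
      inter_subset_left (h.encard_attachment_le hZ u.2)
      (fun x hx y hxy => hcovV u x y hx.1 (fun hxY => hx.2 ⟨hx.1, hxY⟩) hxy) rfl
    refine ⟨c, hck, ?_⟩
    have : V u \ (V u ∩ Y) = V u \ Y := sdiff_self_inter
    rw [← this]
    exact hc
  choose cV hcVk hcV using hrec
  have hz : ∀ x, ∃ t, x ∈ Y → t ∈ Z ∧ x ∈ X t := by
    intro x
    by_cases hx : x ∈ Y
    · obtain ⟨t, ht⟩ := mem_bagUnion.1 hx
      exact ⟨t, fun _ => ht⟩
    · exact ⟨c₀, fun hx' => absurd hx' hx⟩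
  choose z hz using hz
  -- The guard overrides the bag colours; its value `1` is where `2 ≤ k` is needed. Interiors of
  -- pieces are disjoint, so the choice of a piece is immaterial.
  let c : α → ℕ := fun x =>
    if x ∈ N1 then 0 else if x ∈ N2 then 1 else if x ∈ Y then f (z x) x else
      if hx : ∃ u, x ∈ V u then cV hx.choose x else 0
  have hN1Y : N1 ⊆ Y := (subset_union_left.trans subset_union_right).trans hGZ
  have hN2Y : N2 ⊆ Y := (subset_union_right.trans subset_union_right).trans hGZ
  have hcint : ∀ u, ∀ x ∈ V u \ Y, c x = cV u x := by
    rintro u x ⟨hx, hxY⟩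
    have hex : ∃ u, x ∈ V u := ⟨u, hx⟩
    have h1 : hex.choose = u := huniq _ _ x hex.choose_spec hx hxY
    simp only [c]
    rw [if_neg fun h => hxY (hN1Y h), if_neg fun h => hxY (hN2Y h), if_neg hxY, dif_pos hex, h1]
  set B := (S ∪ (N1 ∪ N2)) ∪ E with hB
  have hzB : ∀ x ∈ Y \ B, x ∈ X (z x) ∧ c x = f (z x) x := by
    rintro x ⟨hxY, hxB⟩
    refine ⟨(hz x hxY).2, ?_⟩
    simp only [c]
    rw [if_neg fun h => hxB (Or.inl (Or.inr (Or.inl h))),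
      if_neg fun h => hxB (Or.inl (Or.inr (Or.inr h))), if_pos hxY]
  have hzu : ∀ x ∈ Y \ B, ∀ t ∈ Z, x ∈ X t → z x = t := fun x hx t ht hxt =>
    hE1 x (fun hxE => hx.2 (Or.inr hxE)) _ (hz x hx.1).1 t ht (hz x hx.1).2 hxt
  have hattach : ∀ u : {u // IsGate par Z u}, ∀ x ∈ Y \ B, x ∈ V u →
      x ∈ X (u : ι) ∩ X (par u) ∧ z x = par u := by
    intro u x hx hxu
    have := hE2 u u.2 x (fun hxE => hx.2 (Or.inr hxE)) hxu hx.1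
    exact ⟨this, hzu x hx _ u.2.1 this.2⟩
  refine ⟨c, ?_, ?_, ?_, ?_⟩
  · intro x hx
    by_cases hxY : x ∈ Y
    · have := hfk (z x) x (hz x hxY).2
      simp only [c]
      split_ifs <;> omega
    · obtain ⟨u, hu⟩ := hunion x hx hxY
      rw [hcint u x ⟨hu, hxY⟩]
      exact hcVk u x hu
  · intro x hx hs
    exact if_pos ⟨hx, hs⟩
  · intro x hx hs y hy hsy hyx
    have h1 : x ∉ N1 := fun hx1 => hs hx1.2
    have h2 : x ∈ N2 := ⟨hx, y, ⟨hy, hsy⟩, hyx⟩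
    simp only [c]
    rw [if_neg h1, if_pos h2]
    exact one_ne_zero
  · have hVY : bagUnion X C = Y ∪ ⋃ u, V u := by
      refine Subset.antisymm (fun x hx => ?_) (union_subset hYC (iUnion_subset hVC))
      by_cases hxY : x ∈ Y
      · exact Or.inl hxY
      · exact Or.inr (mem_iUnion.2 (hunion x hx hxY))
    rw [hVY]
    have hBcard : B.encard ≤ exceptionBound η d := by
      refine (encard_union_le _ _).trans ?_
      unfold exceptionBound
      rw [Nat.cast_add]
      exact add_le_add hGcard hEcard
    refine encard_relComponent_le_of_pieces (R := childTorsoRel Adj par X) hsymm hd hBcard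
      (fun u x y hx hxY hxy => ?_) (fun u => h.encard_attachment_le hZ u.2)
      (fun u => (hcV u).congr (hcint u)) hzB ?_ ?_ (fun t x y hxy => Or.inl hxy) hf hf0 hN le_rfl
    · obtain ⟨t, ht, -, hyt⟩ := hcovV u x y hx hxY hxy
      exact mem_bagUnion.2 ⟨t, ht, hyt⟩
    · intro x hx y hy hxy
      obtain ⟨t, ht, hxt, hyt⟩ := hcov x
        ⟨hYC hx.1, fun hxS => hx.2 (Or.inl (Or.inl hxS))⟩ y hxy
      -- The edge lies in a bag at `Z`, the only such bag for both ends, or in a piece, which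
      -- outside `B` attaches only to the bag at `par u`.
      by_cases htZ : t ∈ Z
      · rw [hzu x hx t htZ hxt, hzu y hy t htZ hyt]
      · obtain ⟨u, hu, htu⟩ := h.exists_gate hc₀ hleast ht htZ
        rw [(hattach ⟨u, hu⟩ x hx (mem_bagUnion.2 ⟨t, htu, hxt⟩)).2,
          (hattach ⟨u, hu⟩ y hy (mem_bagUnion.2 ⟨t, htu, hyt⟩)).2]
    · intro u x hx y hy hxu hyu
      have h1 := hattach u x hx hxu
      have h2 := hattach u y hy hyu
      refine ⟨h1.2.trans h2.2.symm, Or.inr ⟨u, h1.2.symm, u.2.2, ?_, ?_⟩⟩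
      · rw [h1.2]; exact h1.1
      · rw [h1.2]; exact h2.1

end Coloring

/-! ### Application to graphs and their torsos -/

variable {α : Type u} {β : Type v} {ι : Type w} {G : Graph α β}

theorem adj_induce_iff {A : Set α} {x y : α} :
    (G.induce A).Adj x y ↔ G.Adj x y ∧ x ∈ A ∧ y ∈ A :=
  ⟨fun ⟨e, he⟩ => ⟨⟨e, he.1⟩, he.2⟩, fun ⟨⟨e, he⟩, hA⟩ => ⟨e, he, hA⟩⟩

theorem componentAt_induce (A : Set α) (x : α) :
    (G.induce A).componentAt x = relComponent G.Adj A x := by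
  have : (G.induce A).Adj = fun a b => G.Adj a b ∧ a ∈ A ∧ b ∈ A := by
    ext a b
    exact adj_induce_iff
  simp only [componentAt, relComponent, this]

theorem encard_setOf_adj_le_degreeENat (x : α) : {y | G.Adj x y}.encard ≤ G.degreeENat x := by
  refine le_trans ?_ (le_self_add (b := (G.loopSet x).encard))
  rcases isEmpty_or_nonempty β with hβ | hβ
  · have : {y | G.Adj x y} = ∅ := eq_empty_of_forall_notMem fun y ⟨e, _⟩ => hβ.elim e
    simp [this]
  have hex : ∀ y ∈ {y | G.Adj x y}, ∃ e, G.IsLink e x y := fun y hy => hy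
  choose! e he using hex
  refine encard_le_encard_of_injOn (f := e) (fun y hy => ⟨y, he y hy⟩) ?_
  intro y hy y' hy' heq
  have h2 := he y' hy'
  rw [← heq] at h2
  exact (he y hy).right_unique h2

theorem encard_setOf_adj_le_maxDegreeENat (x : α) :
    {y | G.Adj x y}.encard ≤ G.maxDegreeENat := by
  by_cases hx : x ∈ G.vertexSet
  · exact (encard_setOf_adj_le_degreeENat x).trans (le_iSup₂_of_le x hx le_rfl)
  · have : {y | G.Adj x y} = ∅ := eq_empty_of_forall_notMem fun y hy => hx hy.left_mem
    simp [this]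

/-- The colour classes of a clustered colouring have small components, also at the points outside
the graph. -/
theorem ColorableWithClustering.exists_relComponent {k N : ℕ}
    (h : G.ColorableWithClustering k N) (hN : 1 ≤ N) :
    ∃ c : α → ℕ, (∀ x ∈ G.vertexSet, c x < k) ∧
      ∀ i x, (relComponent G.Adj {y ∈ G.vertexSet | c y = i} x).encard ≤ N := by
  obtain ⟨c, hck, hc⟩ := h
  refine ⟨c, hck, fun i x => ?_⟩
  by_cases hx : x ∈ {y ∈ G.vertexSet | c y = i}
  · rw [← componentAt_induce]
    exact hc i (hx.2 ▸ hck x hx.1) x hx.1 hx.2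
  · rw [relComponent_of_notMem hx, encard_singleton]
    exact_mod_cast hN

namespace TreeDecomposition

variable (D : G.TreeDecomposition ι)

theorem exists_isRootedDecomposition {η : ℕ} (hη : D.adhesion ≤ η) :
    ∃ (_ : SemilatticeInf ι) (par : ι → ι), IsRootedDecomposition par D.bag η ∧
      ∀ v w : ι, ¬ v ≤ w → D.tree.Adj v (par v) := by
  obtain ⟨_, par, hpar, hadj, hedge⟩ := D.isTree.exists_isParentFunction
  refine ⟨inferInstance, par, { hpar with sep := ?_, encard_le := ?_ }, hadj⟩
  · intro x a b e hxa hxb hea heb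
    have hxV : x ∈ G.vertexSet := D.iUnion_bag ▸ mem_iUnion.2 ⟨a, hxa⟩
    obtain ⟨p⟩ := (D.connected x hxV).preconnected ⟨a, hxa⟩ ⟨b, hxb⟩
    -- A walk through nodes containing `x` must leave the up-set of `e`, and the only tree edge out
    -- of it joins `e` to `par e`.
    obtain ⟨⟨⟨s, s'⟩, hss'⟩, -, hs, hs'⟩ :=
      p.exists_boundary_dart {t | e ≤ (t : ι)} hea heb
    have htree : D.tree.Adj s s' := hss'
    simp only [mem_ofPred_eq] at hs hs'
    rcases hedge _ _ htree with h | h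
    · have hes : e = s := by
        refine hs.eq_or_lt.resolve_right fun hlt => hs' (h ▸ hpar.le_par hlt)
      rw [hes, h]
      exact ⟨s.2, s'.2⟩
    · exact absurd (hs.trans (h ▸ hpar.par_le s')) hs'
  · intro a b hab
    refine le_trans ?_ hη
    exact le_iSup_of_le a (le_iSup_of_le (par a) (le_iSup_of_le (hadj a b hab) le_rfl))

/-- Equality is allowed because the clique relation on an adhesion set relates a vertex to itself,
whereas the added torso edges are not loops. -/
theorem adj_torso {t : ι} {x y : α} (h : G.Adj x y ∨
      ∃ t', D.tree.Adj t t' ∧ x ∈ D.bag t ∩ D.bag t' ∧ y ∈ D.bag t ∩ D.bag t')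
    (hx : x ∈ D.bag t) (hy : y ∈ D.bag t) : x = y ∨ (D.torso t).Adj x y := by
  by_cases hxy : x = y
  · exact Or.inl hxy
  refine Or.inr ?_
  by_cases hadj : G.Adj x y
  · obtain ⟨e, he⟩ := hadj
    exact ⟨Sum.inl e, Or.inl ⟨e, rfl, he, hx, hy⟩⟩
  · exact ⟨Sum.inr s(x, y), Or.inr ⟨rfl, hxy, hadj, h.resolve_left hadj⟩⟩

/-- Colourings of the bags in which colour `0` is clustered in the torsos and all other colours are
clustered in the bags can be combined. -/
theorem colorableWithClustering_of_bagColoring [Finite ι] {η d N k : ℕ} (hη : D.adhesion ≤ η)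
    (hd : G.maxDegreeENat ≤ d) (hN : 1 ≤ N) (hk : 2 ≤ k) {f : ι → α → ℕ}
    (hfk : ∀ t, ∀ x ∈ D.bag t, f t x < k)
    (hf : ∀ i x t, i ≠ 0 → (relComponent G.Adj {y ∈ D.bag t | f t y = i} x).encard ≤ N)
    (hf0 : ∀ x t, (relComponent (fun x y => x = y ∨ (D.torso t).Adj x y)
      {y ∈ D.bag t | f t y = 0} x).encard ≤ N) :
    G.ColorableWithClustering k (clusteringBound η d N) := by
  obtain ⟨_, par, h, hadj⟩ := D.exists_isRootedDecomposition hη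
  have hV : bagUnion D.bag univ = G.vertexSet := by simp [bagUnion, D.iUnion_bag]
  have hf0' : ∀ x t, (relComponent (childTorsoRel G.Adj par D.bag t)
      {y ∈ D.bag t | f t y = 0} x).encard ≤ N := by
    intro x t
    refine (encard_le_encard fun y hy => ?_).trans (hf0 x t)
    refine ReflTransGen.mono (fun a b hab => ⟨?_, hab.2⟩) _ _ hy
    refine D.adj_torso (hab.1.imp_right ?_) hab.2.1.1 hab.2.2.1
    rintro ⟨u, rfl, hlt, ha, hb⟩
    exact ⟨u, (hadj u _ hlt.not_ge).symm, ha.symm, hb.symm⟩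
  have hcov : ∀ x ∈ bagUnion D.bag univ \ ∅, ∀ y, G.Adj x y →
      ∃ t ∈ (univ : Set ι), x ∈ D.bag t ∧ y ∈ D.bag t := by
    rintro x - y ⟨e, he⟩
    obtain ⟨t, ht⟩ := D.exists_bag_of_isLink e x y he
    exact ⟨t, mem_univ _, ht⟩
  -- The whole tree with empty boundary: the guard is then void.
  obtain ⟨c, hck, hc⟩ := h.exists_isGuardedColoring (fun _ _ h => h.symm)
    (fun x => (encard_setOf_adj_le_maxDegreeENat x).trans hd) hN hk hfk hf hf0'
    (fun _ _ _ _ => mem_univ _) (empty_subset _) (by simp) hcov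
  rw [hV, sdiff_empty] at hc
  rw [hV] at hck
  refine ⟨c, hck, fun i _ x _ _ => ?_⟩
  rw [componentAt_induce]
  exact hc.encard_le i x

theorem colorableWithClustering_of_torso [Finite ι] {η d N k : ℕ} (hη : D.adhesion ≤ η)
    (hd : G.maxDegreeENat ≤ d) (hN : 1 ≤ N) (hk : 2 ≤ k)
    (h : ∀ t, (D.torso t).ColorableWithClustering k N) :
    G.ColorableWithClustering k (clusteringBound η d N) := by
  choose f hfk hf using fun t => (h t).exists_relComponent hN
  refine D.colorableWithClustering_of_bagColoring hη hd hN hk hfk (fun i x t _ => ?_)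
    fun x t => ?_
  · refine (encard_le_encard fun y hy => ?_).trans (hf t i x)
    refine ReflTransGen.mono (fun a b hab => ⟨?_, hab.2⟩) _ _ hy
    obtain ⟨e, he⟩ := hab.1
    exact ⟨Sum.inl e, Or.inl ⟨e, rfl, he, hab.2.1.1, hab.2.2.1⟩⟩
  · refine (encard_le_encard fun y hy => ?_).trans (hf t 0 x)
    induction hy with
    | refl => exact ReflTransGen.refl
    | tail _ hab ih =>
      rcases hab.1 with rfl | hadj
      · exact ih
      · exact ReflTransGen.tail ih ⟨hadj, hab.2⟩

theorem colorableWithClustering_succ_of_bag [Finite ι] {η d N k : ℕ} (hη : D.adhesion ≤ η)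
    (hd : G.maxDegreeENat ≤ d) (hN : 1 ≤ N)
    (h : ∀ t, (G.induce (D.bag t)).ColorableWithClustering k N) :
    G.ColorableWithClustering (k + 1) (clusteringBound η d N) := by
  choose f hfk hf using fun t => (h t).exists_relComponent hN
  -- The gluing needs `k + 1 ≥ 2`; with `k = 0` all bags are empty.
  rcases Nat.eq_zero_or_pos k with rfl | hk
  · have hV : ∀ x, x ∉ G.vertexSet := by
      intro x hx
      rw [← D.iUnion_bag] at hx
      obtain ⟨t, ht⟩ := mem_iUnion.1 hx
      exact Nat.not_lt_zero _ (hfk t x ht)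
    exact ⟨fun _ => 0, fun x hx => absurd hx (hV x), fun _ _ x hx => absurd hx (hV x)⟩
  refine D.colorableWithClustering_of_bagColoring hη hd hN (Nat.succ_le_succ hk)
    (f := fun t x => f t x + 1) (fun t x hx => Nat.succ_lt_succ (hfk t x hx))
    (fun i x t hi => ?_) fun x t => ?_
  · obtain ⟨i, rfl⟩ := Nat.exists_eq_succ_of_ne_zero hi
    refine (encard_le_encard fun y hy => ?_).trans (hf t i x)
    refine ReflTransGen.mono (fun a b hab => ?_) _ _ hy
    obtain ⟨hadj, ha, hb⟩ := hab
    exact ⟨adj_induce_iff.2 ⟨hadj, ha.1, hb.1⟩, ⟨ha.1, Nat.succ_injective ha.2⟩,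
      hb.1, Nat.succ_injective hb.2⟩
  -- After the shift no vertex of a bag has colour `0`, so the torso condition is trivial.
  · rw [relComponent_of_notMem (by simp), encard_singleton]
    exact_mod_cast hN

end TreeDecomposition

end Graph

theorem corollary1p4 (η d N : ℕ) (hη : 0 < η) (hd : 0 < d) (hN : 0 < N) :
    ∃ Nstar : ℕ, 0 < Nstar ∧
      ∀ (k : ℕ) (α : Type u) (β : Type v) (ι : Type w) [Finite ι] (G : Graph α β)
        (D : G.TreeDecomposition ι),
        G.vertexSet.Finite → G.edgeSet.Finite →
        G.maxDegreeENat ≤ d → D.adhesion ≤ η →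
        (2 ≤ k → (∀ t, (D.torso t).ColorableWithClustering k N) →
          G.ColorableWithClustering k Nstar) ∧
        ((∀ t, (G.induce (D.bag t)).ColorableWithClustering k N) →
          G.ColorableWithClustering (k + 1) Nstar) := by
  refine ⟨Graph.clusteringBound η d N, ?_, ?_⟩
  · unfold Graph.clusteringBound Graph.addPointsBound
    omega
  · intro k α β ι _ G D _ _ hdeg hadh
    exact ⟨fun hk h => D.colorableWithClustering_of_torso hadh hdeg hN hk h,
      fun h => D.colorableWithClustering_succ_of_bag hadh hdeg hN h⟩
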